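/- Setting. Let $X=(T,W)$ be observed covariates, with treatments $T=(X_1,\dots,X_J)$ and controls $W\in\mathbb R^K$, and let $U\in\mathcal U$, $V\in\mathcal V$ be unobserved, all on one probability space, with $X\in\mathcal X$ almost surely. The latent outcome is $H=h(X,U)$, where $h(x,u)\in\mathcal H\subseteq\mathbb R$ for $x\in\mathcal X$, and $\mathcal H$ is contained in the closure of its interior (e.g. a nondegenerate interval). The report is $R=r(H,V)$ with $r:\mathcal H\times\mathcal V\to\{0,1,\dots,\bar R\}$. Write $\tau_v(k)=\sup\{y\in\mathcal H: r(y,v)\le k\}\in[-\infty,\infty]$. For a point $x=(t,w)$, $f(\cdot\,|x,v)$ denotes the density of $H$ given $X=x,V=v$ (set to $0$ at $\pm\infty$ and outside $\mathcal H$), and $f_j(\cdot,\cdot\,|x,v)$ the joint density of $(H,\partial_{x_j}h(x,U))$ given $X=x,V=v$. Say that $x$ is interior to $\mathcal X$ along $x_j$ if all small changes of its $j$-th component stay in $\mathcal X$. Assumptions. HONEST: for every $v$, $r(\cdot,v)$ is weakly increasing and left-continuous on $\mathcal H$. EXOG: $T$ and $V$ are conditionally independent given $W$, and $T$ and $U$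 are conditionally independent given $(W,V)$. Hence regular conditional laws $F_{V|W}$ and $F_{U|W,V}$ are also conditional laws of $V$ given $X$ and of $U$ given $(X,V)$. All conditional quantities at a point $x=(t,w)$ (or $(x,v)$) below are computed from fixed versions of these two; in particular $$\mathbb E[R|X=x]=\iint r(h(x,u),v)\,dF_{U|W,V}(u|w,v)\,dF_{V|W}(v|w).$$ REG for the component $j\in\{1,\dots,J\}$: $X_j$ has an absolutely continuous distribution and, for all $v\in\mathcal V$ and all $x$ interior to $\mathcal X$ along $x_j$: (i) $\partial_{x_j}h(x,u)$ exists for all $u$; (ii) the densities $f(\cdot|x,v)$ and $f_j(\cdot,\cdot|x,v)$ exist, $f_j\ge 0$ is jointly measurable in all its arguments and vanishes for $y\notin\mathcal H$, and $f(y|x,v)=\int f_j(y,z|x,v)\,dz<\infty$; (iii) $f_j(y,z|x,v)\le c(z)$ for a function $c$ that does not depend on $x,v,y$ and satisfies $\int c(z)|z|\,dz<\infty$; (iv) for every $y\in\mathcal H$ and almost every $z$, $f_j(\cdot,z|x,v)$ is continuous at $y$ within $\mathcal H$ and $f_j(y,z|\cdot,v)$ is continuous at $x$ in the component $x_j$.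 For $j$ satisfying REG put $\mathbb E[\partial_{x_j}h(x,U)|H=y,x,v]=\int z\,f_j(y,z|x,v)/f(y|x,v)\,dz$. Claim. Under HONEST and EXOG, the function $x\mapsto\mathbb E[R|X=x]$ displayed above is a version of the conditional expectation of $R$ given $X$. For every $j$ satisfying REG and every $x=(t,w)$ interior to $\mathcal X$ along $x_j$, its partial derivative with respect to $x_j$ exists at $x$ and $$\partial_{x_j}\mathbb E[R|X=x]=\int\sum_{k=0}^{\bar R-1} f(\tau_v(k)|x,v)\cdot\mathbb E\left[\partial_{x_j}h(x,U)\,\middle|\,H=\tau_v(k),x,v\right]dF_{V|W}(v|w),$$ where the integrand is integrable and the weights $f(\tau_v(k)|x,v)$ are nonnegative. Equivalently, with $\nabla_x$ the vector of partial derivatives with respect to the components of $T$ that satisfy REG, $$\nabla_x\mathbb E[R|X=x]=\mathbb E\left\{\sum_{k=0}^{\bar R-1} f(\tau_V(k)|x,V)\cdot\mathbb E\left[\nabla_xh(x,U)\,\middle|\,H=\tau_V(k),x,V\right]\,\middle|\,X=x\right\}.$$ -/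

import Mathlib

open MeasureTheory ProbabilityTheory Filter Topology

namespace SubjectiveReports

/-- Values `x = (t, w)` of the explanatory variables: `t` collects the `J` treatment components and
`w` the `K` control components. -/
abbrev Covariates (J K : ℕ) : Type := (Fin J → ℝ) × (Fin K → ℝ)

/-- The point obtained from `x = (t, w)` by setting its `j`-th treatment component to `s`. -/
def setTreatment {J K : ℕ} (x : Covariates J K) (j : Fin J) (s : ℝ) : Covariates J K :=
  (Function.update x.1 j s, x.2)

/-- `x` belongs to `𝒳`, together with all points that differ from it by a small change of the
`j`-th treatment component. -/
def InteriorAlong {J K : ℕ} (𝒳 : Set (Covariates J K)) (j : Fin J) (x : Covariates J K) : Prop :=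
  ∀ᶠ s in 𝓝 (x.1 j), setTreatment x j s ∈ 𝒳

/-- The structural partial derivative `∂_{x_j} h (x, u)`. -/
noncomputable def partialH {J K : ℕ} {𝒰 : Type*} (h : Covariates J K → 𝒰 → ℝ) (j : Fin J)
    (x : Covariates J K) (u : 𝒰) : ℝ :=
  deriv (fun s => h (setTreatment x j s) u) (x.1 j)

/-- Weak honesty: every reporting function `r (·, v)` is weakly increasing and left-continuous on
the set `𝓗` of latent values. -/
def Honest {𝒱 : Type*} (𝓗 : Set ℝ) (r : ℝ → 𝒱 → ℕ) : Prop :=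
  ∀ v, MonotoneOn (fun y => r y v) 𝓗 ∧
    ∀ y ∈ 𝓗, ContinuousWithinAt (fun y' => r y' v) (𝓗 ∩ Set.Iic y) y

/-- The threshold `τ_v(k) = sup {y ∈ 𝓗 | r (y, v) ≤ k}`, as an extended real number. -/
noncomputable def threshold {𝒱 : Type*} (𝓗 : Set ℝ) (r : ℝ → 𝒱 → ℕ) (v : 𝒱) (k : ℕ) : EReal :=
  sSup ((fun y : ℝ => (y : EReal)) '' {y | y ∈ 𝓗 ∧ r y v ≤ k})

/-- The value of a density at an extended real number; a density vanishes at `±∞`. -/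
noncomputable def densityAt (f : ℝ → ℝ) (a : EReal) : ℝ :=
  if a = ⊤ ∨ a = ⊥ then 0 else f a.toReal

/-- `E[∂_{x_j} h (x, U) | H = y, X = x, V = v]`, computed from the conditional density
`z ↦ g(y, z | x, v) / f(y | x, v)` of `∂_{x_j} h (x, U)` given `H = y`, `X = x`, `V = v`. Here `g`
is the joint density of `(H, ∂_{x_j} h)`, and `f` the density of `H`, both given `X = x`,
`V = v`. -/
noncomputable def localResponse {J K : ℕ} {𝒱 : Type*} (f : Covariates J K → 𝒱 → ℝ → ℝ)
    (g : Covariates J K → 𝒱 → ℝ → ℝ → ℝ) (x : Covariates J K) (v : 𝒱) (y : ℝ) : ℝ :=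
  ∫ z, z * (g x v y z / f x v y)

/-- `E[R | X = x]` for `R = r (h (X, U), V)`, where `κ w` is the law of `V` given `W = w` and
`η (w, v)` is the law of `U` given `W = w`, `V = v`. -/
noncomputable def meanReport {J K : ℕ} {𝒰 𝒱 : Type*} [MeasurableSpace 𝒰] [MeasurableSpace 𝒱]
    (h : Covariates J K → 𝒰 → ℝ) (r : ℝ → 𝒱 → ℕ)
    (κ : Kernel (Fin K → ℝ) 𝒱) (η : Kernel ((Fin K → ℝ) × 𝒱) 𝒰) (x : Covariates J K) : ℝ :=
  ∫ v, ∫ u, (r (h x u) v : ℝ) ∂(η (x.2, v)) ∂(κ x.2)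

/-- The regularity conditions for the `j`-th treatment component. `T` is the vector of treatments,
`η (w, v)` the law of `U` given `W = w`, `V = v`, `f x v` the density of `H` given `X = x`, `V = v`,
and `g x v` the joint density of `(H, ∂_{x_j} h)` given `X = x`, `V = v`. -/
structure Regular {Ω : Type*} [MeasurableSpace Ω] {J K : ℕ} {𝒰 𝒱 : Type*} [MeasurableSpace 𝒰]
    [MeasurableSpace 𝒱] (μ : Measure Ω) (T : Ω → Fin J → ℝ) (𝒳 : Set (Covariates J K)) (𝓗 : Set ℝ)
    (h : Covariates J K → 𝒰 → ℝ) (η : Kernel ((Fin K → ℝ) × 𝒱) 𝒰)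
    (f : Covariates J K → 𝒱 → ℝ → ℝ) (g : Covariates J K → 𝒱 → ℝ → ℝ → ℝ) (j : Fin J) : Prop where
  /-- The `j`-th treatment is continuously distributed. -/
  continuous_treatment : μ.map (fun ω => T ω j) ≪ volume
  /-- The partial derivative of `h` with respect to `x_j` exists. -/
  differentiable : ∀ x, InteriorAlong 𝒳 j x → ∀ u,
    DifferentiableAt ℝ (fun s => h (setTreatment x j s) u) (x.1 j)
  /-- `f x v` is a density of `H` given `X = x`, `V = v`. -/
  density : ∀ x, InteriorAlong 𝒳 j x → ∀ v,
    (η (x.2, v)).map (h x) = volume.withDensity (fun y => ENNReal.ofReal (f x v y))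
  /-- `g x v` is a density of `(H, ∂_{x_j} h)` given `X = x`, `V = v`. -/
  joint_density : ∀ x, InteriorAlong 𝒳 j x → ∀ v,
    (η (x.2, v)).map (fun u => (h x u, partialH h j x u)) =
      (volume : Measure (ℝ × ℝ)).withDensity (fun p => ENNReal.ofReal (g x v p.1 p.2))
  joint_measurable : Measurable
    (fun p : (Covariates J K × 𝒱) × ℝ × ℝ => g p.1.1 p.1.2 p.2.1 p.2.2)
  joint_nonneg : ∀ x v y z, 0 ≤ g x v y z
  /-- Latent values outside `𝓗` do not occur. -/
  joint_support : ∀ x v, ∀ y ∉ 𝓗, ∀ z, g x v y z = 0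
  /-- `f` is the marginal density belonging to `g`. -/
  marginal : ∀ x, InteriorAlong 𝒳 j x → ∀ v y,
    Integrable (g x v y) ∧ f x v y = ∫ z, g x v y z
  /-- The joint density is bounded by a function of the slope alone, with a finite first absolute
  moment. -/
  bound : ∃ c : ℝ → ℝ, Integrable (fun z => c z * |z|) ∧
    ∀ x, InteriorAlong 𝒳 j x → ∀ v y z, g x v y z ≤ c z
  /-- The joint density is the continuous version in the latent value. -/
  continuous_latent : ∀ x, InteriorAlong 𝒳 j x → ∀ v, ∀ y ∈ 𝓗, ∀ᵐ z,
    ContinuousWithinAt (fun y' => g x v y' z) 𝓗 y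
  /-- The joint density is the continuous version in the treatment component. -/
  continuous_along : ∀ x, InteriorAlong 𝒳 j x → ∀ v, ∀ y ∈ 𝓗, ∀ᵐ z,
    ContinuousAt (fun s => g (setTreatment x j s) v y z) (x.1 j)

end SubjectiveReports

/-! A report counts the thresholds strictly below the latent value: on `𝓗`, `r y v` is the sum over
`k < Rbar` of the indicator of `τ_v(k) < y`. Hence the mean report is an average over `v` of sums of
survival probabilities `P(h(x, U) > τ_v(k))`. By exogeneity the laws `κ w` and `η (w, v)` do not
involve the treatments, so a change of `x_j` acts only through `h`.

It remains to differentiate `P(H_s > a)` along `x_j`. For a bounded primitive `φ` of `ψ`, the chain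
rule and Fubini express the change of `E φ(H_s)` as the integral over `σ` of `∫ ψ(y) m_σ(y) dy`,
where `m_σ(y) = ∫ z g(y, z) dz` is the slope moment (`integral_primitive_sub`). Letting `ψ` shrink
to a point mass at `a` inside `𝓗` gives `P(H_t > a) - P(H_s > a) = ∫_s^t m_σ(a) dσ`
(`survival_sub`). Continuity of `m_σ(a)` in `σ` gives the derivative, which equals the density times
the local mean response; the bound `|m| ≤ ∫ c(z)|z| dz` gives a Lipschitz constant independent of
`a` and `v`, so differentiation passes under the integral over `v` (`Regular.survival`,
`Regular.hasDerivAt_meanReport`). A threshold outside `𝓗` contributes nothing: continuous paths in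
`𝓗` cannot cross it, and the density vanishes there. -/

namespace SubjectiveReports

/-! ### Conditional laws under conditional independence and composition. -/

section Conditional

variable {Ω α β γ : Type*} [MeasurableSpace Ω] [MeasurableSpace α] [MeasurableSpace β]
  [MeasurableSpace γ] {μ : Measure Ω}

lemma condDistrib_ae_eq_of_hasCondDistrib [IsFiniteMeasure μ] [StandardBorelSpace β] [Nonempty β] {X : Ω → α} {Y : Ω → β}
    {κ : Kernel α β} [IsFiniteKernel κ] (h : HasCondDistrib Y X κ μ) :
    condDistrib Y X μ =ᵐ[μ.map X] κ :=
  condDistrib_ae_eq_of_measure_eq_compProd X h.aemeasurable_snd h.map_eq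

/-- A conditional law of `Y` given `X` is one given `(X, Z)`, if `Z` and `Y` are conditionally
independent given `X`. -/
lemma hasCondDistrib_prodMk_of_condIndepFun [IsFiniteMeasure μ] [StandardBorelSpace Ω] [StandardBorelSpace β]
    [Nonempty β] [StandardBorelSpace γ] [Nonempty γ] {X : Ω → α} {Y : Ω → β} {Z : Ω → γ}
    {κ : Kernel α β} [IsMarkovKernel κ] (h : HasCondDistrib Y X κ μ) (hX : Measurable X)
    (hY : Measurable Y) (hZ : Measurable Z)
    (hZY : CondIndepFun (MeasurableSpace.comap X inferInstance) hX.comap_le Z Y μ) :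
    HasCondDistrib Y (fun ω => (X ω, Z ω)) (κ.prodMkRight γ) μ := by
  refine ⟨by fun_prop, ?_⟩
  rw [condIndepFun_iff_condDistrib_prod_ae_eq_prodMkRight hY hZ hX] at hZY
  rw [← compProd_map_condDistrib hY.aemeasurable]
  refine Measure.compProd_congr (hZY.trans ?_)
  have h1 := condDistrib_ae_eq_of_hasCondDistrib h
  have h2 : μ.map X = (μ.map (fun ω => (X ω, Z ω))).map Prod.fst := by
    rw [Measure.map_map measurable_fst (hX.prodMk hZ)]; rfl
  rw [h2] at h1
  filter_upwards [ae_of_ae_map measurable_fst.aemeasurable h1] with p hp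
  exact hp

/-- Reparametrization of the conditioning variable by a measurable equivalence. -/
lemma hasCondDistrib_comp_equiv [IsFiniteMeasure μ] {α' : Type*} [MeasurableSpace α'] {X : Ω → α} {Y : Ω → β}
    {κ : Kernel α β} [IsSFiniteKernel κ] (h : HasCondDistrib Y X κ μ) (e : α' ≃ᵐ α) :
    HasCondDistrib Y (fun ω => e.symm (X ω)) (κ.comap e e.measurable) μ :=
  HasCondDistrib.measurableEquiv_comp_right h e.symm

lemma hasCondDistrib_compProd {X : Ω → α} {Y : Ω → β} {Z : Ω → γ} {κ : Kernel α β}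
    {η : Kernel (α × β) γ} [IsMarkovKernel κ] [IsMarkovKernel η] (hY : HasCondDistrib Y X κ μ)
    (hZ : HasCondDistrib Z (fun ω => (X ω, Y ω)) η μ) :
    HasCondDistrib (fun ω => (Y ω, Z ω)) X (κ ⊗ₖ η) μ := by
  have hX' := hY.aemeasurable_fst
  have hY' := hY.aemeasurable_snd
  have hZ' := hZ.aemeasurable_snd
  refine ⟨by fun_prop, ?_⟩
  have h1 := hZ.map_eq
  rw [hY.map_eq] at h1
  have h2 : μ.map (fun ω => (X ω, Y ω, Z ω)) =
      (μ.map (fun ω => ((X ω, Y ω), Z ω))).map MeasurableEquiv.prodAssoc := by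
    rw [AEMeasurable.map_map_of_aemeasurable (by fun_prop) (by fun_prop)]
    rfl
  rw [h2, h1, ← Measure.compProd_assoc,
    Measure.map_map (by fun_prop) (by fun_prop)]
  convert Measure.map_id
  ext p <;> rfl

end Conditional

/-! ### Consequences of exogeneity; the mean report as a conditional expectation. -/

section Exogeneity

variable {Ω 𝒰 𝒱 : Type*} [MeasurableSpace Ω]
  [MeasurableSpace 𝒰] [StandardBorelSpace 𝒰] [MeasurableSpace 𝒱]
  {μ : Measure Ω} [IsProbabilityMeasure μ] {J K : ℕ}
  {T : Ω → Fin J → ℝ} {W : Ω → Fin K → ℝ} {U : Ω → 𝒰} {V : Ω → 𝒱}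
  {κ : Kernel (Fin K → ℝ) 𝒱} [IsMarkovKernel κ] {η : Kernel ((Fin K → ℝ) × 𝒱) 𝒰} [IsMarkovKernel η]

lemma hasCondDistrib_report_type [StandardBorelSpace Ω] [StandardBorelSpace 𝒱]
    (hT : Measurable T) (hW : Measurable W) (hV : Measurable V)
    (exog_V : CondIndepFun (MeasurableSpace.comap W inferInstance) hW.comap_le T V μ)
    (h_κ : HasCondDistrib V W κ μ) :
    HasCondDistrib V (fun ω => (T ω, W ω))
      (κ.comap (fun x : Covariates J K => x.2) (by fun_prop)) μ := by
  obtain ⟨ω₀⟩ := nonempty_of_isProbabilityMeasure μ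
  have : Nonempty 𝒱 := ⟨V ω₀⟩
  exact hasCondDistrib_comp_equiv (hasCondDistrib_prodMk_of_condIndepFun h_κ hW hV hT exog_V)
    MeasurableEquiv.prodComm

lemma hasCondDistrib_outcome_type [StandardBorelSpace Ω] (hT : Measurable T) (hW : Measurable W) (hU : Measurable U)
    (hV : Measurable V)
    (exog_U : CondIndepFun (MeasurableSpace.comap (fun ω => (W ω, V ω)) inferInstance)
      (hW.prodMk hV).comap_le T U μ)
    (h_η : HasCondDistrib U (fun ω => (W ω, V ω)) η μ) :
    HasCondDistrib U (fun ω => ((T ω, W ω), V ω))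
      (η.comap (fun p : Covariates J K × 𝒱 => (p.1.2, p.2)) (by fun_prop)) μ := by
  obtain ⟨ω₀⟩ := nonempty_of_isProbabilityMeasure μ
  have : Nonempty 𝒰 := ⟨U ω₀⟩
  exact hasCondDistrib_comp_equiv (hasCondDistrib_prodMk_of_condIndepFun h_η (hW.prodMk hV) hU hT exog_U)
    (MeasurableEquiv.prodAssoc.trans MeasurableEquiv.prodComm)

/-- The composed kernel is the conditional law of `(V, U)` given `X`, and integrating against it is
the iterated integral. Reports are bounded only for covariates in `𝒳`, hence the almost sure
arguments. -/
lemma meanReport_ae_eq_condExp [StandardBorelSpace 𝒱] (hT : Measurable T) (hW : Measurable W) (hU : Measurable U)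
    (hV : Measurable V) {𝒳 : Set (Covariates J K)} (h_𝒳 : ∀ᵐ ω ∂μ, (T ω, W ω) ∈ 𝒳) {𝓗 : Set ℝ}
    {h : Covariates J K → 𝒰 → ℝ} (h_meas : Measurable (fun p : Covariates J K × 𝒰 => h p.1 p.2))
    (h_range : ∀ x ∈ 𝒳, ∀ u, h x u ∈ 𝓗)
    {Rbar : ℕ} {r : ℝ → 𝒱 → ℕ} (r_meas : Measurable (fun p : ℝ × 𝒱 => r p.1 p.2))
    (r_range : ∀ y ∈ 𝓗, ∀ v, r y v ≤ Rbar)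
    (h_V : HasCondDistrib V (fun ω => (T ω, W ω))
      (κ.comap (fun x : Covariates J K => x.2) (by fun_prop)) μ)
    (h_U : HasCondDistrib U (fun ω => ((T ω, W ω), V ω))
      (η.comap (fun p : Covariates J K × 𝒱 => (p.1.2, p.2)) (by fun_prop)) μ) :
    (fun ω => meanReport h r κ η (T ω, W ω)) =ᵐ[μ]
      μ[(fun ω => (r (h (T ω, W ω) (U ω)) (V ω) : ℝ)) |
        MeasurableSpace.comap (fun ω => (T ω, W ω)) inferInstance] := by
  obtain ⟨ω₀⟩ := nonempty_of_isProbabilityMeasure μ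
  have : Nonempty 𝒰 := ⟨U ω₀⟩
  have : Nonempty 𝒱 := ⟨V ω₀⟩
  have hX : Measurable (fun ω => (T ω, W ω)) := hT.prodMk hW
  have hVU := hasCondDistrib_compProd h_V h_U
  set φ : Covariates J K × (𝒱 × 𝒰) → ℝ := fun p => (r (h p.1 p.2.2) p.2.1 : ℝ) with hφ
  have hφm : Measurable φ := by
    have h1 : Measurable (fun p : Covariates J K × (𝒱 × 𝒰) => (h p.1 p.2.2, p.2.1)) :=
      (h_meas.comp (measurable_fst.prodMk measurable_snd.snd)).prodMk measurable_snd.fst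
    exact measurable_from_top.comp (r_meas.comp h1)
  have hbound : ∀ x ∈ 𝒳, ∀ p : 𝒱 × 𝒰, ‖φ (x, p)‖ ≤ Rbar := fun x hx p => by
    simpa [hφ] using r_range _ (h_range x hx p.2) p.1
  have hint : Integrable (fun ω => φ ((T ω, W ω), (V ω, U ω))) μ := by
    refine Integrable.of_bound (hφm.comp (hX.prodMk (hV.prodMk hU))).aestronglyMeasurable Rbar ?_
    filter_upwards [h_𝒳] with ω hω using hbound _ hω _
  refine EventuallyEq.trans ?_ (condExp_prod_ae_eq_integral_condDistrib hX
    (hV.prodMk hU).aemeasurable hφm.stronglyMeasurable hint).symm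
  filter_upwards [h_𝒳, ae_of_ae_map hX.aemeasurable (condDistrib_ae_eq_of_hasCondDistrib hVU)] with ω hω hker
  rw [hker, ProbabilityTheory.integral_compProd]
  · rfl
  · exact Integrable.of_bound (hφm.comp measurable_prodMk_left).aestronglyMeasurable Rbar
      (ae_of_all _ (hbound _ hω))

end Exogeneity

/-! ### Slope moments and the chain rule in expectation. -/

/-- A differentiable family `s ↦ H s u`, indexed by `s ∈ B`, for which the pair of value and slope
has the joint density `G s`, dominated by a function `c` of the slope with finite first moment. -/
structure HasSlopeDensity {𝒰 : Type*} [MeasurableSpace 𝒰] (P : Measure 𝒰) (B : Set ℝ)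
    (H : ℝ → 𝒰 → ℝ) (G : ℝ → ℝ → ℝ → ℝ) (c : ℝ → ℝ) : Prop where
  measurable : Measurable (fun p : ℝ × 𝒰 => H p.1 p.2)
  differentiableAt : ∀ s ∈ B, ∀ u, DifferentiableAt ℝ (fun σ => H σ u) s
  law : ∀ s ∈ B, P.map (fun u => (H s u, deriv (fun σ => H σ u) s)) =
    (volume : Measure (ℝ × ℝ)).withDensity (fun p => ENNReal.ofReal (G s p.1 p.2))
  density_measurable : Measurable (fun p : ℝ × ℝ × ℝ => G p.1 p.2.1 p.2.2)
  nonneg : ∀ s y z, 0 ≤ G s y z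
  moment : Integrable (fun z => c z * |z|)
  bound : ∀ s ∈ B, ∀ y z, G s y z ≤ c z

/-- The integral of the slope `z` against a joint density of value and slope at the value `y`. -/
noncomputable def slopeMoment (G : ℝ → ℝ → ℝ → ℝ) (s y : ℝ) : ℝ := ∫ z, z * G s y z

namespace HasSlopeDensity

variable {𝒰 : Type*} [MeasurableSpace 𝒰] {P : Measure 𝒰} {B : Set ℝ} {H : ℝ → 𝒰 → ℝ}
  {G : ℝ → ℝ → ℝ → ℝ} {c : ℝ → ℝ}

lemma norm_mul_le (hG : HasSlopeDensity P B H G c) {s : ℝ} (hs : s ∈ B) (y z : ℝ) :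
    ‖z * G s y z‖ ≤ c z * |z| := by
  rw [norm_mul, Real.norm_eq_abs, Real.norm_eq_abs, abs_of_nonneg (hG.nonneg s y z), mul_comm]
  exact mul_le_mul_of_nonneg_right (hG.bound s hs y z) (abs_nonneg z)

lemma measurable_mul (hG : HasSlopeDensity P B H G c) (s y : ℝ) :
    Measurable (fun z => z * G s y z) :=
  measurable_id.mul (hG.density_measurable.comp (by fun_prop : Measurable fun z : ℝ => (s, y, z)))

lemma integrable_mul (hG : HasSlopeDensity P B H G c) {s : ℝ} (hs : s ∈ B) (y : ℝ) :
    Integrable (fun z => z * G s y z) :=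
  hG.moment.mono' (hG.measurable_mul s y).aestronglyMeasurable
    (ae_of_all _ fun z => hG.norm_mul_le hs y z)

lemma integral_norm_mul_le (hG : HasSlopeDensity P B H G c) {s : ℝ} (hs : s ∈ B) (y : ℝ) :
    ∫ z, ‖z * G s y z‖ ≤ ∫ z, c z * |z| :=
  integral_mono (hG.integrable_mul hs y).norm hG.moment fun z => hG.norm_mul_le hs y z

lemma norm_slopeMoment_le (hG : HasSlopeDensity P B H G c) {s : ℝ} (hs : s ∈ B) (y : ℝ) :
    ‖slopeMoment G s y‖ ≤ ∫ z, c z * |z| :=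
  (norm_integral_le_integral_norm _).trans (hG.integral_norm_mul_le hs y)

lemma measurable_slopeMoment (hG : HasSlopeDensity P B H G c) :
    Measurable (fun p : ℝ × ℝ => slopeMoment G p.1 p.2) := by
  have h1 : Measurable (fun q : (ℝ × ℝ) × ℝ => q.2 * G q.1.1 q.1.2 q.2) :=
    measurable_snd.mul (hG.density_measurable.comp
      (by fun_prop : Measurable fun q : (ℝ × ℝ) × ℝ => (q.1.1, q.1.2, q.2)))
  exact h1.stronglyMeasurable.integral_prod_right.measurable

/-- The slope moment inherits continuity in the value from the density. -/
lemma continuousWithinAt_slopeMoment (hG : HasSlopeDensity P B H G c) {s : ℝ} (hs : s ∈ B)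
    {D : Set ℝ} {a : ℝ} (hcont : ∀ᵐ z, ContinuousWithinAt (fun y => G s y z) D a) :
    ContinuousWithinAt (slopeMoment G s) D a := by
  refine tendsto_integral_filter_of_dominated_convergence (fun z => c z * |z|)
    (.of_forall fun y => (hG.measurable_mul s y).aestronglyMeasurable)
    (.of_forall fun y => ae_of_all _ fun z => hG.norm_mul_le hs y z) hG.moment ?_
  filter_upwards [hcont] with z hz using hz.tendsto.const_mul z

/-- The slope moment inherits continuity in the parameter from the density. -/
lemma continuousAt_slopeMoment (hG : HasSlopeDensity P B H G c) {s : ℝ} (hs : B ∈ 𝓝 s) {a : ℝ}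
    (hcont : ∀ᵐ z, ContinuousAt (fun σ => G σ a z) s) :
    ContinuousAt (fun σ => slopeMoment G σ a) s := by
  refine tendsto_integral_filter_of_dominated_convergence (fun z => c z * |z|)
    (.of_forall fun σ => (hG.measurable_mul σ a).aestronglyMeasurable)
    (by filter_upwards [hs] with σ hσ using ae_of_all _ fun z => hG.norm_mul_le hσ a z)
    hG.moment ?_
  filter_upwards [hcont] with z hz using hz.tendsto.const_mul z

/-- On `B` the derivative is the limit of difference quotients with steps `1 / (n + 1)`. The
indicator removes the parameters at which differentiability is not assumed. -/
lemma measurable_deriv (hG : HasSlopeDensity P B H G c) (hB : MeasurableSet B) :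
    Measurable (fun p : ℝ × 𝒰 => B.indicator (fun s => deriv (fun σ => H σ p.2) s) p.1) := by
  have hq : ∀ n : ℕ, Measurable (fun p : ℝ × 𝒰 => B.indicator
      (fun s => ((1 : ℝ) / (n + 1))⁻¹ * (H (s + 1 / (n + 1)) p.2 - H s p.2)) p.1) := fun n => by
    have h1 : Measurable (fun p : ℝ × 𝒰 =>
        ((1 : ℝ) / (n + 1))⁻¹ * (H (p.1 + 1 / (n + 1)) p.2 - H p.1 p.2)) :=
      ((hG.measurable.comp (by fun_prop : Measurable fun p : ℝ × 𝒰 =>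
        (p.1 + 1 / ((n : ℝ) + 1), p.2))).sub hG.measurable).const_mul _
    exact h1.indicator (measurable_fst hB)
  refine measurable_of_tendsto_metrizable hq (tendsto_pi_nhds.2 fun p => ?_)
  by_cases hp : p.1 ∈ B
  · simp only [Set.indicator_of_mem hp]
    have h2 := (hG.differentiableAt p.1 hp p.2).hasDerivAt.tendsto_slope_zero_right
    exact h2.comp (tendsto_nhdsWithin_iff.2 ⟨tendsto_one_div_add_atTop_nhds_zero_nat,
      .of_forall fun n => by simp only [Set.mem_Ioi]; positivity⟩)
  · simp [Set.indicator_of_notMem hp]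

lemma measurable_section (hG : HasSlopeDensity P B H G c) (s : ℝ) : Measurable (H s) :=
  hG.measurable.comp measurable_prodMk_left

lemma measurable_deriv_section (hG : HasSlopeDensity P B H G c) (hB : MeasurableSet B) {s : ℝ}
    (hs : s ∈ B) : Measurable (fun u => deriv (fun σ => H σ u) s) := by
  simpa [Function.comp_def, Set.indicator_of_mem hs] using
    (hG.measurable_deriv hB).comp (measurable_prodMk_left (x := s))

/-- The slope integral is bounded uniformly in the value, so integrability of `ψ` takes care of the
value coordinate. The bound is also uniform in `s`, which later justifies Fubini over the parameter.
-/
lemma integrable_weighted (hG : HasSlopeDensity P B H G c) {s : ℝ} (hs : s ∈ B)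
    {ψ : ℝ → ℝ} (hψ : Measurable ψ) (hψi : Integrable ψ) :
    Integrable (fun p : ℝ × ℝ => ψ p.1 * (p.2 * G s p.1 p.2)) ∧
      ∫ p : ℝ × ℝ, ‖ψ p.1 * (p.2 * G s p.1 p.2)‖ ≤ (∫ y, |ψ y|) * ∫ z, c z * |z| := by
  have hm : Measurable (fun p : ℝ × ℝ => ψ p.1 * (p.2 * G s p.1 p.2)) :=
    (hψ.comp measurable_fst).mul (measurable_snd.mul (hG.density_measurable.comp
      (by fun_prop : Measurable fun p : ℝ × ℝ => (s, p.1, p.2))))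
  have hle : ∀ y, ∫ z, ‖ψ y * (z * G s y z)‖ ≤ |ψ y| * ∫ z, c z * |z| := fun y => by
    simp only [norm_mul (ψ y), integral_const_mul, Real.norm_eq_abs (ψ y)]
    exact mul_le_mul_of_nonneg_left (hG.integral_norm_mul_le hs y) (abs_nonneg _)
  have hi : Integrable (fun y => ∫ z, ‖ψ y * (z * G s y z)‖) := by
    refine (hψi.abs.mul_const (∫ z, c z * |z|)).mono'
      hm.norm.stronglyMeasurable.integral_prod_right.aestronglyMeasurable (ae_of_all _ fun y => ?_)
    rw [Real.norm_of_nonneg (integral_nonneg fun z => norm_nonneg _)]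
    exact hle y
  have hint : Integrable (fun p : ℝ × ℝ => ψ p.1 * (p.2 * G s p.1 p.2)) :=
    (integrable_prod_iff hm.aestronglyMeasurable).2
      ⟨ae_of_all _ fun y => (hG.integrable_mul hs y).const_mul (ψ y), hi⟩
  refine ⟨hint, ?_⟩
  rw [Measure.volume_eq_prod, integral_prod _ hint.norm, ← integral_mul_const]
  exact integral_mono hi (hψi.abs.mul_const _) hle

lemma measurable_density (hG : HasSlopeDensity P B H G c) (s : ℝ) :
    Measurable (fun p : ℝ × ℝ => (G s p.1 p.2).toNNReal) :=
  (hG.density_measurable.comp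
    (by fun_prop : Measurable fun p : ℝ × ℝ => (s, p.1, p.2))).real_toNNReal

lemma toNNReal_smul_eq (hG : HasSlopeDensity P B H G c) (s : ℝ) (ψ : ℝ → ℝ) :
    (fun p : ℝ × ℝ => (G s p.1 p.2).toNNReal • (ψ p.1 * p.2)) =
      fun p => ψ p.1 * (p.2 * G s p.1 p.2) := by
  ext p
  rw [NNReal.smul_def, Real.coe_toNNReal _ (hG.nonneg _ _ _), smul_eq_mul]
  ring

/-- Change of variables to the joint density. -/
lemma integrable_comp (hG : HasSlopeDensity P B H G c) (hB : MeasurableSet B) {s : ℝ} (hs : s ∈ B)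
    {ψ : ℝ → ℝ} (hψ : Measurable ψ) (hψi : Integrable ψ) :
    Integrable (fun u => ψ (H s u) * deriv (fun σ => H σ u) s) P := by
  have hφ : Measurable fun u => (H s u, deriv (fun σ => H σ u) s) :=
    (hG.measurable_section s).prodMk (hG.measurable_deriv_section hB hs)
  have h1 : Integrable (fun p : ℝ × ℝ => ψ p.1 * p.2)
      (P.map (fun u => (H s u, deriv (fun σ => H σ u) s))) := by
    rw [hG.law s hs]
    refine (integrable_withDensity_iff_integrable_smul (hG.measurable_density s)).2 ?_
    rw [hG.toNNReal_smul_eq]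
    exact (hG.integrable_weighted hs hψ hψi).1
  exact h1.comp_measurable hφ

lemma integral_norm_comp_le (hG : HasSlopeDensity P B H G c) (hB : MeasurableSet B) {s : ℝ}
    (hs : s ∈ B) {ψ : ℝ → ℝ} (hψ : Measurable ψ) (hψi : Integrable ψ) :
    ∫ u, ‖ψ (H s u) * deriv (fun σ => H σ u) s‖ ∂P ≤ (∫ y, |ψ y|) * ∫ z, c z * |z| := by
  have hφ : Measurable fun u => (H s u, deriv (fun σ => H σ u) s) :=
    (hG.measurable_section s).prodMk (hG.measurable_deriv_section hB hs)
  have hm : Measurable (fun p : ℝ × ℝ => ‖ψ p.1 * p.2‖) :=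
    ((hψ.comp measurable_fst).mul measurable_snd).norm
  refine le_trans (le_of_eq ?_) (hG.integrable_weighted hs hψ hψi).2
  rw [← integral_map (f := fun p : ℝ × ℝ => ‖ψ p.1 * p.2‖) hφ.aemeasurable
    hm.aestronglyMeasurable, hG.law s hs]
  refine (integral_withDensity_eq_integral_smul (hG.measurable_density s) _).trans ?_
  refine integral_congr_ae (ae_of_all _ fun p => ?_)
  have := congrFun (hG.toNNReal_smul_eq s ψ) p
  simp only at this ⊢
  rw [← this, NNReal.smul_def, NNReal.smul_def, norm_smul, smul_eq_mul, NNReal.norm_eq]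

lemma integral_comp_eq (hG : HasSlopeDensity P B H G c) (hB : MeasurableSet B) {s : ℝ} (hs : s ∈ B)
    {ψ : ℝ → ℝ} (hψ : Measurable ψ) (hψi : Integrable ψ) :
    ∫ u, ψ (H s u) * deriv (fun σ => H σ u) s ∂P = ∫ y, ψ y * slopeMoment G s y := by
  have hφ : Measurable fun u => (H s u, deriv (fun σ => H σ u) s) :=
    (hG.measurable_section s).prodMk (hG.measurable_deriv_section hB hs)
  have hm : Measurable (fun p : ℝ × ℝ => ψ p.1 * p.2) :=
    (hψ.comp measurable_fst).mul measurable_snd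
  rw [← integral_map (f := fun p : ℝ × ℝ => ψ p.1 * p.2) hφ.aemeasurable
    hm.aestronglyMeasurable, hG.law s hs]
  refine (integral_withDensity_eq_integral_smul (hG.measurable_density s) _).trans ?_
  rw [hG.toNNReal_smul_eq, Measure.volume_eq_prod,
    integral_prod _ (hG.integrable_weighted hs hψ hψi).1]
  simp only [integral_const_mul, slopeMoment]

/-- The change of `E φ(H s)` in the parameter, for a primitive `φ` of an integrable function. -/
lemma integral_primitive_sub [IsFiniteMeasure P] (hG : HasSlopeDensity P B H G c)
    (hB : MeasurableSet B) {s t : ℝ} (hst : Set.uIcc s t ⊆ B) {φ ψ : ℝ → ℝ}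
    (hψ : Measurable ψ) (hψi : Integrable ψ) (hφ : ∀ y, HasDerivAt φ (ψ y) y)
    {M : ℝ} (hM : ∀ y, ‖φ y‖ ≤ M) :
    ∫ u, φ (H t u) ∂P - ∫ u, φ (H s u) ∂P =
      ∫ σ in s..t, ∫ y, ψ y * slopeMoment G σ y := by
  have hIoc : Set.uIoc s t ⊆ B := Set.uIoc_subset_uIcc.trans hst
  have hφm : Measurable φ :=
    (continuous_iff_continuousAt.2 fun y => (hφ y).continuousAt).measurable
  have hφi : ∀ σ, Integrable (fun u => φ (H σ u)) P := fun σ =>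
    Integrable.of_bound (hφm.comp (hG.measurable_section σ)).aestronglyMeasurable M
      (ae_of_all _ fun u => hM _)
  have hmem : ∀ᵐ σ ∂(volume.restrict (Set.uIoc s t)), σ ∈ B := by
    filter_upwards [ae_restrict_mem measurableSet_uIoc] with σ hσ using hIoc hσ
  have hmeas : AEStronglyMeasurable
      (Function.uncurry fun σ u => ψ (H σ u) * deriv (fun σ' => H σ' u) σ)
      ((volume.restrict (Set.uIoc s t)).prod P) := by
    refine (((hψ.comp hG.measurable).mul (hG.measurable_deriv hB)).aestronglyMeasurable).congr ?_
    have h1 : ∀ᵐ p ∂((volume.restrict (Set.uIoc s t)).prod P), p.1 ∈ B :=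
      Measure.quasiMeasurePreserving_fst.ae hmem
    filter_upwards [h1] with p hp
    simp [Function.uncurry, Set.indicator_of_mem hp]
  have hint : Integrable (Function.uncurry fun σ u => ψ (H σ u) * deriv (fun σ' => H σ' u) σ)
      ((volume.restrict (Set.uIoc s t)).prod P) := by
    refine (integrable_prod_iff hmeas).2 ⟨?_, ?_⟩
    · filter_upwards [hmem] with σ hσ using hG.integrable_comp hB hσ hψ hψi
    · have : IsFiniteMeasure ((volume : Measure ℝ).restrict (Set.uIoc s t)) :=
        ⟨by simp [Set.uIoc]⟩
      refine Integrable.of_bound hmeas.norm.integral_prod_right'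
        ((∫ y, |ψ y|) * ∫ z, c z * |z|) ?_
      filter_upwards [hmem] with σ hσ
      rw [Real.norm_of_nonneg (integral_nonneg fun z => norm_nonneg _)]
      exact hG.integral_norm_comp_le hB hσ hψ hψi
  rw [← integral_sub (hφi t) (hφi s)]
  have hftc : ∀ᵐ u ∂P, φ (H t u) - φ (H s u) =
      ∫ σ in s..t, ψ (H σ u) * deriv (fun σ' => H σ' u) σ := by
    -- Fubini makes the derivative integrable in `σ` for almost every `u`; with differentiability
    -- everywhere on the segment, this suffices for the fundamental theorem without continuity of
    -- the slope.
    filter_upwards [hint.prod_left_ae] with u hu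
    refine (intervalIntegral.integral_eq_sub_of_hasDerivAt (f := fun σ => φ (H σ u))
      (fun σ hσ => ?_) (intervalIntegrable_iff.2 hu)).symm
    exact (hφ (H σ u)).comp σ (hG.differentiableAt σ (hst hσ) u).hasDerivAt
  rw [integral_congr_ae hftc, ← intervalIntegral_integral_swap hint]
  refine intervalIntegral.integral_congr fun σ hσ => ?_
  exact hG.integral_comp_eq hB (hst hσ) hψ hψi

end HasSlopeDensity

/-! ### Approximation of a point mass from inside a set. -/

/-- Nonnegative continuous approximations of the point mass at `a` that are supported in `D`,
along with bounded primitives. -/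
lemma exists_approximate_pointMass {D : Set ℝ} {a : ℝ} (ha : a ∈ closure (interior D)) :
    ∃ ψ φ : ℕ → ℝ → ℝ, (∀ n, Continuous (ψ n)) ∧ (∀ n, Integrable (ψ n)) ∧ (∀ n y, 0 ≤ ψ n y) ∧
      (∀ n, ∫ y, ψ n y = 1) ∧ (∀ n y, ψ n y ≠ 0 → y ∈ D ∧ |y - a| < 2 / (n + 1)) ∧
      (∀ n y, HasDerivAt (φ n) (ψ n y) y) ∧ (∀ n y, ‖φ n y‖ ≤ 1) ∧
      ∀ y, y ≠ a → Tendsto (fun n => φ n y) atTop (𝓝 ((Set.Ioi a).indicator (fun _ => 1) y)) := by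
  have hbump : ∀ n : ℕ, ∃ ρ : ℝ → ℝ, Continuous ρ ∧ Integrable ρ ∧ (∀ y, 0 ≤ ρ y) ∧
      ∫ y, ρ y = 1 ∧ ∀ y, ρ y ≠ 0 → y ∈ D ∧ |y - a| < 2 / (n + 1) := fun n => by
    have hn : (0 : ℝ) < 1 / (n + 1) := by positivity
    -- The bump is centred at an interior point `b` near `a`, since `a` may be a boundary point of
    -- `D`. Distance to `b` and outer radius are each at most `1 / (n + 1)`, whence the `2 / (n +
    -- 1)`.
    obtain ⟨b, hb, hab⟩ := Metric.mem_closure_iff.1 ha _ hn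
    obtain ⟨ε, hε, hball⟩ := Metric.isOpen_iff.1 isOpen_interior b hb
    have hδ : 0 < min ε (1 / (n + 1)) := lt_min hε hn
    let β : ContDiffBump b := ⟨min ε (1 / (n + 1)) / 2, min ε (1 / (n + 1)), by linarith, by linarith⟩
    refine ⟨β.normed volume, β.continuous_normed, β.integrable_normed, β.nonneg_normed,
      β.integral_normed, fun y hy => ?_⟩
    have hy' : y ∈ Metric.ball b (min ε (1 / (n + 1))) := by
      rw [← Function.mem_support, β.support_normed_eq] at hy
      exact hy
    rw [Metric.mem_ball] at hy'
    refine ⟨interior_subset (hball (hy'.trans_le (min_le_left _ _))), ?_⟩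
    rw [← Real.dist_eq]
    calc dist y a ≤ dist y b + dist b a := dist_triangle _ _ _
      _ < 1 / (n + 1) + 1 / (n + 1) :=
        add_lt_add (hy'.trans_le (min_le_right _ _)) (by rwa [dist_comm])
      _ = 2 / (n + 1) := by ring
  choose ψ hc hi h0 h1 hs using hbump
  have hs2 : ∀ n y, ψ n y ≠ 0 → |y - a| < 2 := fun n y hy =>
    (hs n y hy).2.trans_le (div_le_self zero_le_two (by linarith [n.cast_nonneg (α := ℝ)]))
  -- All supports lie within distance `2` of `a`, so `a - 3` is to their left. Once `2 / (n + 1) <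
  -- |y - a|`, the primitive at `y` is exactly `0` or `1`.
  refine ⟨ψ, fun n y => ∫ t in (a - 3)..y, ψ n t, hc, hi, h0, h1, hs, fun n y => ?_, fun n y => ?_,
    fun y hy => ?_⟩
  · exact ((hc n).integral_hasStrictDerivAt (a - 3) y).hasDerivAt
  · refine intervalIntegral.norm_integral_le_integral_norm_uIoc.trans ?_
    rw [← h1 n]
    refine (setIntegral_le_integral (hi n).norm (ae_of_all _ fun t => norm_nonneg _)).trans ?_
    exact le_of_eq (integral_congr_ae (ae_of_all _ fun t => Real.norm_of_nonneg (h0 n t)))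
  · have hlim : Tendsto (fun n : ℕ => (2 : ℝ) / (n + 1)) atTop (𝓝 0) := by
      simpa [div_eq_mul_inv] using
        (tendsto_one_div_add_atTop_nhds_zero_nat (𝕜 := ℝ)).const_mul 2
    have hev := hlim.eventually (gt_mem_nhds (abs_pos.2 (sub_ne_zero.2 hy)))
    refine tendsto_const_nhds.congr' ?_
    filter_upwards [hev] with n hn
    rcases lt_or_gt_of_ne hy with hlt | hgt
    · rw [abs_of_neg (sub_neg.2 hlt)] at hn
      rw [Set.indicator_of_notMem (by simpa using hlt.le)]
      refine (intervalIntegral.integral_zero_ae (ae_of_all _ fun t ht => ?_)).symm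
      by_contra hne
      have hta := abs_lt.1 (hs n t hne).2
      have hta2 := abs_lt.1 (hs2 n t hne)
      rcases Set.mem_uIoc.1 ht with h' | h' <;> linarith [h'.1, h'.2]
    · rw [abs_of_pos (sub_pos.2 hgt)] at hn
      rw [Set.indicator_of_mem (by simpa using hgt),
        intervalIntegral.integral_of_le (by linarith),
        setIntegral_eq_integral_of_forall_compl_eq_zero, h1]
      intro t ht
      by_contra hne
      have hta := abs_lt.1 (hs n t hne).2
      have hta2 := abs_lt.1 (hs2 n t hne)
      exact ht ⟨by linarith, by linarith⟩

/-- Continuity within `D` is enough because the weights vanish off `D`. -/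
lemma tendsto_integral_approximate_pointMass {D : Set ℝ} {a : ℝ} {ψ : ℕ → ℝ → ℝ}
    (hi : ∀ n, Integrable (ψ n)) (h0 : ∀ n y, 0 ≤ ψ n y) (h1 : ∀ n, ∫ y, ψ n y = 1)
    (hs : ∀ n y, ψ n y ≠ 0 → y ∈ D ∧ |y - a| < 2 / (n + 1))
    {m : ℝ → ℝ} (hm : Measurable m) {C : ℝ} (hC : ∀ y, ‖m y‖ ≤ C) (hcont : ContinuousWithinAt m D a) :
    Tendsto (fun n => ∫ y, ψ n y * m y) atTop (𝓝 (m a)) := by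
  rw [Metric.tendsto_nhds]
  intro ε hε
  obtain ⟨δ, hδ, hδm⟩ := Metric.continuousWithinAt_iff.1 hcont (ε / 2) (half_pos hε)
  have hlim : Tendsto (fun n : ℕ => (2 : ℝ) / (n + 1)) atTop (𝓝 0) := by
    simpa [div_eq_mul_inv] using
      (tendsto_one_div_add_atTop_nhds_zero_nat (𝕜 := ℝ)).const_mul 2
  filter_upwards [hlim.eventually (gt_mem_nhds hδ)] with n hn
  have him : Integrable (fun y => ψ n y * m y) :=
    (hi n).mul_bdd hm.aestronglyMeasurable (ae_of_all _ hC)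
  have hconst : m a = ∫ y, ψ n y * m a := by rw [integral_mul_const, h1, one_mul]
  rw [dist_eq_norm]
  calc ‖(∫ y, ψ n y * m y) - m a‖
      = ‖∫ y, (ψ n y * m y - ψ n y * m a)‖ := by
        rw [integral_sub him ((hi n).mul_const _), ← hconst]
    _ ≤ ∫ y, ψ n y * (ε / 2) := by
        refine norm_integral_le_of_norm_le ((hi n).mul_const _) (ae_of_all _ fun y => ?_)
        rw [← mul_sub, norm_mul, Real.norm_of_nonneg (h0 n y)]
        by_cases hy : ψ n y = 0
        · simp [hy]
        · refine mul_le_mul_of_nonneg_left ?_ (h0 n y)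
          rw [← dist_eq_norm]
          exact (hδm (hs n y hy).1 (by rw [Real.dist_eq]; exact (hs n y hy).2.trans hn)).le
    _ = ε / 2 := by rw [integral_mul_const, h1, one_mul]
    _ < ε := half_lt_self hε

/-! ### Derivative of the survival function. -/

namespace HasSlopeDensity

variable {𝒰 : Type*} [MeasurableSpace 𝒰] {P : Measure 𝒰} {B : Set ℝ} {H : ℝ → 𝒰 → ℝ}
  {G : ℝ → ℝ → ℝ → ℝ} {c : ℝ → ℝ}

/-- The change of the survival function at `a` is the integral of the slope moment at `a`. -/
theorem survival_sub [IsFiniteMeasure P] (hG : HasSlopeDensity P B H G c)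
    (hB : MeasurableSet B) {s t : ℝ} (hst : Set.uIcc s t ⊆ B)
    (hac : ∀ σ ∈ B, P.map (H σ) ≪ volume) {D : Set ℝ} {a : ℝ} (ha : a ∈ closure (interior D))
    (hcont : ∀ σ ∈ B, ∀ᵐ z, ContinuousWithinAt (fun y => G σ y z) D a) :
    P.real {u | a < H t u} - P.real {u | a < H s u} = ∫ σ in s..t, slopeMoment G σ a := by
  obtain ⟨ψ, φ, hc, hi, h0, h1, hs, hφ, hφ1, hlim⟩ := exists_approximate_pointMass ha
  have hleft : ∀ σ ∈ B, Tendsto (fun n => ∫ u, φ n (H σ u) ∂P) atTop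
      (𝓝 (P.real {u | a < H σ u})) := fun σ hσ => by
    have hmS : MeasurableSet {u | a < H σ u} :=
      measurableSet_lt measurable_const (hG.measurable_section σ)
    rw [← integral_indicator_one hmS]
    refine tendsto_integral_filter_of_dominated_convergence (fun _ => (1 : ℝ))
      (.of_forall fun n => ?_) (.of_forall fun n => ae_of_all _ fun u => hφ1 n _)
      (integrable_const _) ?_
    · exact ((continuous_iff_continuousAt.2 fun y => (hφ n y).continuousAt).measurable.comp
        (hG.measurable_section σ)).aestronglyMeasurable
    -- The primitives need not converge to the indicator at `a` itself, but the law of `H σ` has no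
    -- atom there.
    · have hne : ∀ᵐ y ∂(P.map (H σ)), y ≠ a := (hac σ hσ).ae_le (Measure.ae_ne volume a)
      filter_upwards [ae_of_ae_map (hG.measurable_section σ).aemeasurable hne] with u hu
      have := hlim _ hu
      by_cases hlt : a < H σ u
      · simpa [Set.indicator_apply, hlt] using this
      · simpa [Set.indicator_apply, hlt] using this
  have hmeas : ∀ n, Measurable (fun σ => ∫ y, ψ n y * slopeMoment G σ y) := fun n =>
    (((hc n).measurable.comp measurable_snd).mul
      hG.measurable_slopeMoment).stronglyMeasurable.integral_prod_right.measurable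
  have hright : Tendsto (fun n => ∫ σ in s..t, ∫ y, ψ n y * slopeMoment G σ y) atTop
      (𝓝 (∫ σ in s..t, slopeMoment G σ a)) := by
    refine intervalIntegral.tendsto_integral_filter_of_dominated_convergence
      (fun _ => ∫ z, c z * |z|) (.of_forall fun n => (hmeas n).aestronglyMeasurable)
      (.of_forall fun n => ae_of_all _ fun σ hσ => ?_) intervalIntegrable_const
      (ae_of_all _ fun σ hσ => ?_)
    · have hσB := hst (Set.uIoc_subset_uIcc hσ)
      calc ‖∫ y, ψ n y * slopeMoment G σ y‖ ≤ ∫ y, ψ n y * ∫ z, c z * |z| := by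
            refine norm_integral_le_of_norm_le ((hi n).mul_const _) (ae_of_all _ fun y => ?_)
            rw [norm_mul, Real.norm_of_nonneg (h0 n y)]
            exact mul_le_mul_of_nonneg_left (hG.norm_slopeMoment_le hσB y) (h0 n y)
        _ = ∫ z, c z * |z| := by rw [integral_mul_const, h1, one_mul]
    · have hσB := hst (Set.uIoc_subset_uIcc hσ)
      exact tendsto_integral_approximate_pointMass hi h0 h1 hs
        (hG.measurable_slopeMoment.comp measurable_prodMk_left) (hG.norm_slopeMoment_le hσB)
        (hG.continuousWithinAt_slopeMoment hσB (hcont σ hσB))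
  refine tendsto_nhds_unique (((hleft t (hst Set.right_mem_uIcc)).sub
    (hleft s (hst Set.left_mem_uIcc))).congr fun n => ?_) hright
  exact hG.integral_primitive_sub hB hst (hc n).measurable (hi n) (hφ n) (hφ1 n)

/-- The constant involves neither `a` nor `P`; this uniformity supplies the domination over
reporting types. -/
lemma abs_survival_sub_le [IsFiniteMeasure P] (hG : HasSlopeDensity P B H G c)
    (hB : MeasurableSet B) {s t : ℝ} (hst : Set.uIcc s t ⊆ B)
    (hac : ∀ σ ∈ B, P.map (H σ) ≪ volume) {D : Set ℝ} {a : ℝ} (ha : a ∈ closure (interior D))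
    (hcont : ∀ σ ∈ B, ∀ᵐ z, ContinuousWithinAt (fun y => G σ y z) D a) :
    |P.real {u | a < H t u} - P.real {u | a < H s u}| ≤ (∫ z, c z * |z|) * |t - s| := by
  rw [hG.survival_sub hB hst hac ha hcont]
  exact intervalIntegral.norm_integral_le_of_norm_le_const fun σ hσ =>
    hG.norm_slopeMoment_le (hst (Set.uIoc_subset_uIcc hσ)) a

/-- The derivative of the survival function at `a` is the slope moment at `a`. -/
theorem hasDerivAt_survival [IsFiniteMeasure P] (hG : HasSlopeDensity P B H G c)
    (hB : IsOpen B) (hconn : B.OrdConnected) {s : ℝ} (hs : s ∈ B)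
    (hac : ∀ σ ∈ B, P.map (H σ) ≪ volume) {D : Set ℝ} {a : ℝ} (ha : a ∈ closure (interior D))
    (hcont : ∀ σ ∈ B, ∀ᵐ z, ContinuousWithinAt (fun y => G σ y z) D a)
    (hcont' : ∀ᵐ z, ContinuousAt (fun σ => G σ a z) s) :
    HasDerivAt (fun t => P.real {u | a < H t u}) (slopeMoment G s a) s := by
  have hm : Measurable (fun σ => slopeMoment G σ a) :=
    hG.measurable_slopeMoment.comp measurable_prodMk_right
  have h1 : HasDerivAt (fun t => ∫ σ in s..t, slopeMoment G σ a) (slopeMoment G s a) s :=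
    intervalIntegral.integral_hasDerivAt_right IntervalIntegrable.refl
      hm.stronglyMeasurable.stronglyMeasurableAtFilter
      (hG.continuousAt_slopeMoment (hB.mem_nhds hs) hcont')
  refine (h1.const_add (P.real {u | a < H s u})).congr_of_eventuallyEq ?_
  filter_upwards [hB.mem_nhds hs] with t ht
  rw [← hG.survival_sub hB.measurableSet (hconn.uIcc_subset hs ht) hac ha hcont]
  ring

end HasSlopeDensity

/-! ### Moving one treatment component. -/

section SetTreatment

variable {J K : ℕ} {x : Covariates J K} {j : Fin J}

@[simp] lemma setTreatment_self : setTreatment x j (x.1 j) = x := by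
  simp [setTreatment]

@[simp] lemma setTreatment_setTreatment (s t : ℝ) :
    setTreatment (setTreatment x j s) j t = setTreatment x j t := by
  simp [setTreatment]

@[simp] lemma setTreatment_fst_same (s : ℝ) : (setTreatment x j s).1 j = s := by
  simp [setTreatment]

@[simp] lemma setTreatment_snd (s : ℝ) : (setTreatment x j s).2 = x.2 := rfl

lemma measurable_setTreatment : Measurable (setTreatment x j) :=
  (measurable_update x.1).prodMk measurable_const

/-- Points near an interior point are interior. -/
lemma InteriorAlong.exists_ball {𝒳 : Set (Covariates J K)} (hx : InteriorAlong 𝒳 j x) :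
    ∃ ε > 0, ∀ s ∈ Metric.ball (x.1 j) ε,
      setTreatment x j s ∈ 𝒳 ∧ InteriorAlong 𝒳 j (setTreatment x j s) := by
  have h1 : ∀ᶠ s in 𝓝 (x.1 j), setTreatment x j s ∈ 𝒳 ∧ InteriorAlong 𝒳 j (setTreatment x j s) := by
    filter_upwards [hx, hx.eventually_nhds] with s hs hs'
    exact ⟨hs, by simpa [InteriorAlong] using hs'⟩
  exact Metric.eventually_nhds_iff_ball.1 h1

end SetTreatment

/-! ### Reports as counts of thresholds. -/

section Threshold

variable {𝒱 : Type*} {𝓗 : Set ℝ} {r : ℝ → 𝒱 → ℕ}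

/-- Under weak honesty, categories above `k` are reported exactly above the threshold. -/
lemma Honest.lt_iff_threshold_lt (honest : Honest 𝓗 r) {v : 𝒱} {k : ℕ} {y : ℝ} (hy : y ∈ 𝓗) :
    k < r y v ↔ threshold 𝓗 r v k < (y : EReal) := by
  rw [← not_iff_not, not_lt, not_lt]
  refine ⟨fun h => le_sSup ⟨y, ⟨hy, h⟩, rfl⟩, fun h => ?_⟩
  by_contra! hlt
  obtain ⟨hmono, hcont⟩ := honest v
  -- Reports are integers, so left-continuity makes them constant just to the left of `y`. A point
  -- of the set defining the supremum lies there, with report at most `k`: a contradiction.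
  have h1 := (hcont y hy).eventually (show ∀ᶠ n in 𝓝 (r y v), n = r y v by simp)
  obtain ⟨ε, hε, hball⟩ := Metric.mem_nhdsWithin_iff.1 h1
  have h2 : ((y - ε : ℝ) : EReal) < threshold 𝓗 r v k :=
    lt_of_lt_of_le (EReal.coe_lt_coe_iff.2 (sub_lt_self y hε)) h
  obtain ⟨-, ⟨y', ⟨hy', hk⟩, rfl⟩, hlt'⟩ := lt_sSup_iff.1 h2
  have h3 : y - ε < y' := EReal.coe_lt_coe_iff.1 hlt'
  have h4 : y' < y := by
    by_contra! hle
    exact absurd (hmono hy hy' hle) (by simp only; omega)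
  have h5 : r y' v = r y v := hball ⟨by
    rw [Metric.mem_ball, Real.dist_eq, abs_of_neg (sub_neg.2 h4)]
    linarith, hy', h4.le⟩
  omega

/-- A report is the number of thresholds below the latent value. -/
lemma Honest.report_eq_sum (honest : Honest 𝓗 r) {Rbar : ℕ} {v : 𝒱} {y : ℝ} (hy : y ∈ 𝓗)
    (hr : r y v ≤ Rbar) :
    (r y v : ℝ) = ∑ k ∈ Finset.range Rbar,
      {y' : ℝ | threshold 𝓗 r v k < (y' : EReal)}.indicator (1 : ℝ → ℝ) y := by
  have h1 : (Finset.range Rbar).filter (fun k => k < r y v) = Finset.range (r y v) := by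
    ext k
    simp only [Finset.mem_filter, Finset.mem_range]
    omega
  have h2 : ∀ k, {y' : ℝ | threshold 𝓗 r v k < (y' : EReal)}.indicator (1 : ℝ → ℝ) y =
      if k < r y v then 1 else 0 := fun k => by
    simp [Set.indicator_apply, honest.lt_iff_threshold_lt hy]
  simp_rw [h2]
  rw [Finset.sum_boole, h1, Finset.card_range]

end Threshold

/-! ### Differentiation of the mean report. -/

section Derivative

variable {Ω : Type*} [MeasurableSpace Ω] {J K : ℕ} {𝒰 𝒱 : Type*} [MeasurableSpace 𝒰]
  [MeasurableSpace 𝒱] {μ : Measure Ω} {T : Ω → Fin J → ℝ} {𝒳 : Set (Covariates J K)} {𝓗 : Set ℝ}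
  {h : Covariates J K → 𝒰 → ℝ} {η : Kernel ((Fin K → ℝ) × 𝒱) 𝒰} {κ : Kernel (Fin K → ℝ) 𝒱}
  {f : Covariates J K → 𝒱 → ℝ → ℝ} {g : Covariates J K → 𝒱 → ℝ → ℝ → ℝ} {j : Fin J}
  {x : Covariates J K}

lemma Regular.density_nonneg (reg : Regular μ T 𝒳 𝓗 h η f g j) (hx : InteriorAlong 𝒳 j x)
    (v : 𝒱) (y : ℝ) : 0 ≤ f x v y := by
  rw [(reg.marginal x hx v y).2]
  exact integral_nonneg (reg.joint_nonneg x v y)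

lemma Regular.density_eq_zero (reg : Regular μ T 𝒳 𝓗 h η f g j) (hx : InteriorAlong 𝒳 j x)
    (v : 𝒱) {y : ℝ} (hy : y ∉ 𝓗) : f x v y = 0 := by
  rw [(reg.marginal x hx v y).2]
  simp [reg.joint_support x v y hy]

lemma Regular.densityAt_nonneg (reg : Regular μ T 𝒳 𝓗 h η f g j) (hx : InteriorAlong 𝒳 j x)
    (v : 𝒱) (a : EReal) : 0 ≤ densityAt (f x v) a := by
  unfold densityAt
  split_ifs
  · exact le_rfl
  · exact reg.density_nonneg hx v _

/-- The density times the local average response is the slope moment of the joint density. -/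
lemma Regular.density_mul_localResponse (reg : Regular μ T 𝒳 𝓗 h η f g j)
    (hx : InteriorAlong 𝒳 j x) (v : 𝒱) (y : ℝ) :
    f x v y * localResponse f g x v y = ∫ z, z * g x v y z := by
  unfold localResponse
  -- Where the marginal density vanishes, the quotient has no meaning, but the nonnegative joint
  -- density is then zero for almost every slope, so both sides are zero.
  by_cases hf : f x v y = 0
  · obtain ⟨hi, heq⟩ := reg.marginal x hx v y
    have h0 : g x v y =ᵐ[volume] 0 :=
      (integral_eq_zero_iff_of_nonneg (reg.joint_nonneg x v y) hi).1 (heq.symm.trans hf)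
    rw [hf, zero_mul, integral_eq_zero_of_ae]
    filter_upwards [h0] with z hz
    simp [hz]
  · rw [← integral_const_mul]
    congr 1
    ext z
    field_simp

/-- Moving a treatment leaves the controls fixed, so the single measure `η (x.2, v)` serves for all
`s`. -/
lemma Regular.hasSlopeDensity (reg : Regular μ T 𝒳 𝓗 h η f g j)
    (h_meas : Measurable (fun p : Covariates J K × 𝒰 => h p.1 p.2)) {B : Set ℝ}
    (hB : ∀ s ∈ B, InteriorAlong 𝒳 j (setTreatment x j s)) {c : ℝ → ℝ}
    (hc : Integrable (fun z => c z * |z|))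
    (hgc : ∀ x, InteriorAlong 𝒳 j x → ∀ v y z, g x v y z ≤ c z) (v : 𝒱) :
    HasSlopeDensity (η (x.2, v)) B (fun s u => h (setTreatment x j s) u)
      (fun s => g (setTreatment x j s) v) c where
  measurable := h_meas.comp
    ((measurable_setTreatment.comp measurable_fst).prodMk measurable_snd)
  differentiableAt s hs u := by
    simpa using reg.differentiable _ (hB s hs) u
  law s hs := by
    simpa [partialH] using reg.joint_density _ (hB s hs) v
  density_measurable := reg.joint_measurable.comp
    (((measurable_setTreatment.comp measurable_fst).prodMk measurable_const).prodMk measurable_snd)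
  nonneg s := reg.joint_nonneg _ v
  moment := hc
  bound s hs := hgc _ (hB s hs) v

/-- A continuous path in `𝓗` does not cross a level outside `𝓗`. -/
lemma lt_iff_lt_of_notMem {B : Set ℝ} (hB : IsPreconnected B) {H : ℝ → ℝ} (hH : ContinuousOn H B)
    (hmem : ∀ s ∈ B, H s ∈ 𝓗) {a : EReal} (ha : ∀ y ∈ 𝓗, a ≠ (y : EReal)) {s t : ℝ} (hs : s ∈ B)
    (ht : t ∈ B) : a < (H s : EReal) ↔ a < (H t : EReal) := by
  have key : ∀ s ∈ B, ∀ t ∈ B, a < (H s : EReal) → a < (H t : EReal) := by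
    intro s hs t ht hlt
    by_contra! hle
    induction a with
    | bot => simp at hle
    | top => simp at hlt
    | coe a =>
      obtain ⟨σ, hσ, hσa⟩ := hB.intermediate_value ht hs hH
        ⟨EReal.coe_le_coe_iff.1 hle, (EReal.coe_lt_coe_iff.1 hlt).le⟩
      exact ha _ (hmem σ hσ) (by rw [hσa])
  exact ⟨key s hs t ht, key t ht s hs⟩

/-- The probability of exceeding a fixed level is Lipschitz in the treatment, with a constant that
depends on neither the level nor the reporting function, and has the expected derivative. -/
lemma Regular.survival (reg : Regular μ T 𝒳 𝓗 h η f g j) [IsFiniteKernel η]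
    (h_𝓗 : 𝓗 ⊆ closure (interior 𝓗))
    (h_meas : Measurable (fun p : Covariates J K × 𝒰 => h p.1 p.2))
    (h_range : ∀ x ∈ 𝒳, ∀ u, h x u ∈ 𝓗) {ε : ℝ} (hε : 0 < ε)
    (hB : ∀ s ∈ Metric.ball (x.1 j) ε,
      setTreatment x j s ∈ 𝒳 ∧ InteriorAlong 𝒳 j (setTreatment x j s)) {c : ℝ → ℝ}
    (hc : Integrable (fun z => c z * |z|))
    (hgc : ∀ x, InteriorAlong 𝒳 j x → ∀ v y z, g x v y z ≤ c z) (v : 𝒱) (a : EReal) :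
    HasDerivAt (fun s => (η (x.2, v)).real {u | a < (h (setTreatment x j s) u : EReal)})
      (densityAt (f x v) a * localResponse f g x v a.toReal) (x.1 j) ∧
    ∀ s ∈ Metric.ball (x.1 j) ε, ∀ t ∈ Metric.ball (x.1 j) ε,
      |(η (x.2, v)).real {u | a < (h (setTreatment x j t) u : EReal)} -
        (η (x.2, v)).real {u | a < (h (setTreatment x j s) u : EReal)}| ≤
          (∫ z, c z * |z|) * |t - s| := by
  set B := Metric.ball (x.1 j) ε with hBdef
  have hxB : x.1 j ∈ B := Metric.mem_ball_self hε
  have hBo : IsOpen B := Metric.isOpen_ball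
  have hconv : Convex ℝ B := convex_ball _ _
  have hx : InteriorAlong 𝒳 j x := by simpa using (hB _ hxB).2
  have hG := reg.hasSlopeDensity h_meas (fun s hs => (hB s hs).2) hc hgc v
  -- Continuity of the joint density is available only at levels in `𝓗`. At any other level,
  -- including `±∞`, the exceedance event is locally constant.
  by_cases ha : ∃ y ∈ 𝓗, a = (y : EReal)
  · obtain ⟨y, hy, rfl⟩ := ha
    have hac : ∀ σ ∈ B, (η (x.2, v)).map (h (setTreatment x j σ)) ≪ volume := fun σ hσ => by
      have h1 := reg.density _ (hB σ hσ).2 v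
      rw [setTreatment_snd] at h1
      rw [h1]
      exact withDensity_absolutelyContinuous _ _
    have hcont : ∀ σ ∈ B, ∀ᵐ z,
        ContinuousWithinAt (fun y => g (setTreatment x j σ) v y z) 𝓗 y := fun σ hσ =>
      reg.continuous_latent _ (hB σ hσ).2 v y hy
    have hcont' := reg.continuous_along x hx v y hy
    simp only [EReal.coe_lt_coe_iff, EReal.toReal_coe]
    refine ⟨?_, fun s hs t ht => ?_⟩
    · have h1 := hG.hasDerivAt_survival hBo hconv.ordConnected hxB hac (h_𝓗 hy) hcont hcont'
      have h2 : densityAt (f x v) (y : EReal) = f x v y := by simp [densityAt]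
      rw [h2, reg.density_mul_localResponse hx]
      simpa [slopeMoment] using h1
    · exact hG.abs_survival_sub_le hBo.measurableSet (hconv.ordConnected.uIcc_subset hs ht) hac
        (h_𝓗 hy) hcont
  · push Not at ha
    have hconst : ∀ s ∈ B, ∀ t ∈ B, {u | a < (h (setTreatment x j s) u : EReal)} =
        {u | a < (h (setTreatment x j t) u : EReal)} := fun s hs t ht => by
      ext u
      exact lt_iff_lt_of_notMem hconv.isPreconnected
        (H := fun σ => h (setTreatment x j σ) u)
        (fun σ hσ => (hG.differentiableAt σ hσ u).continuousAt.continuousWithinAt)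
        (fun σ hσ => h_range _ (hB σ hσ).1 u) ha hs ht
    have hzero : densityAt (f x v) a = 0 := by
      unfold densityAt
      split_ifs with h0
      · rfl
      · push Not at h0
        refine reg.density_eq_zero hx v fun hmem => ha _ hmem ?_
        rw [EReal.coe_toReal h0.1 h0.2]
    refine ⟨?_, fun s hs t ht => ?_⟩
    · rw [hzero, zero_mul]
      refine (hasDerivAt_const (x.1 j) ((η (x.2, v)).real
        {u | a < (h (setTreatment x j (x.1 j)) u : EReal)})).congr_of_eventuallyEq ?_
      filter_upwards [hBo.mem_nhds hxB] with t ht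
      rw [hconst t ht _ hxB]
    · rw [hconst s hs t ht, sub_self, abs_zero]
      -- The value `0` is arbitrary: any slope moment shows that its bound is nonnegative.
      exact mul_nonneg ((norm_nonneg _).trans (hG.norm_slopeMoment_le hxB 0)) (abs_nonneg _)

lemma Honest.integral_report_eq_sum [IsFiniteKernel η]
    (h_meas : Measurable (fun p : Covariates J K × 𝒰 => h p.1 p.2))
    (h_range : ∀ x ∈ 𝒳, ∀ u, h x u ∈ 𝓗) {Rbar : ℕ} {r : ℝ → 𝒱 → ℕ}
    (r_range : ∀ y ∈ 𝓗, ∀ v, r y v ≤ Rbar) (honest : Honest 𝓗 r) (hx : x ∈ 𝒳) (v : 𝒱)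
    (w : Fin K → ℝ) :
    ∫ u, (r (h x u) v : ℝ) ∂(η (w, v)) = ∑ k ∈ Finset.range Rbar,
      (η (w, v)).real {u | threshold 𝓗 r v k < (h x u : EReal)} := by
  have hm : ∀ k, MeasurableSet {u | threshold 𝓗 r v k < (h x u : EReal)} := fun k =>
    measurableSet_lt measurable_const
      (measurable_coe_real_ereal.comp (h_meas.comp measurable_prodMk_left))
  calc ∫ u, (r (h x u) v : ℝ) ∂(η (w, v))
      = ∫ u, ∑ k ∈ Finset.range Rbar,
          {u | threshold 𝓗 r v k < (h x u : EReal)}.indicator (1 : 𝒰 → ℝ) u ∂(η (w, v)) :=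
        integral_congr_ae (ae_of_all _ fun u =>
          honest.report_eq_sum (h_range x hx u) (r_range _ (h_range x hx u) v))
    _ = _ := by
        refine (integral_finsetSum _ fun k _ =>
          (integrable_const (1 : ℝ)).indicator (hm k)).trans ?_
        exact Finset.sum_congr rfl fun k _ => integral_indicator_one (hm k)

/-- The derivative of the mean report with respect to a regular treatment component. -/
theorem Regular.hasDerivAt_meanReport (reg : Regular μ T 𝒳 𝓗 h η f g j) [IsMarkovKernel η]
    [IsMarkovKernel κ] (h_𝓗 : 𝓗 ⊆ closure (interior 𝓗))
    (h_meas : Measurable (fun p : Covariates J K × 𝒰 => h p.1 p.2))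
    (h_range : ∀ x ∈ 𝒳, ∀ u, h x u ∈ 𝓗) {Rbar : ℕ} {r : ℝ → 𝒱 → ℕ}
    (r_meas : Measurable (fun p : ℝ × 𝒱 => r p.1 p.2))
    (r_range : ∀ y ∈ 𝓗, ∀ v, r y v ≤ Rbar) (honest : Honest 𝓗 r) (hx : InteriorAlong 𝒳 j x) :
    Integrable (fun v => ∑ k ∈ Finset.range Rbar,
      densityAt (f x v) (threshold 𝓗 r v k) *
        localResponse f g x v (threshold 𝓗 r v k).toReal) (κ x.2) ∧
    HasDerivAt (fun s => meanReport h r κ η (setTreatment x j s))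
      (∫ v, ∑ k ∈ Finset.range Rbar,
        densityAt (f x v) (threshold 𝓗 r v k) *
          localResponse f g x v (threshold 𝓗 r v k).toReal ∂(κ x.2))
      (x.1 j) := by
  obtain ⟨ε, hε, hB⟩ := hx.exists_ball
  obtain ⟨c, hc, hgc⟩ := reg.bound
  set B := Metric.ball (x.1 j) ε with hBdef
  have hxB : x.1 j ∈ B := Metric.mem_ball_self hε
  have hBn : B ∈ 𝓝 (x.1 j) := Metric.isOpen_ball.mem_nhds hxB
  have hsurv := reg.survival h_𝓗 h_meas h_range hε hB hc hgc
  set F : ℝ → 𝒱 → ℝ := fun s v => ∫ u, (r (h (setTreatment x j s) u) v : ℝ) ∂(η (x.2, v)) with hF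
  have hFsum : ∀ s ∈ B, ∀ v, F s v = ∑ k ∈ Finset.range Rbar, (η (x.2, v)).real
      {u | threshold 𝓗 r v k < (h (setTreatment x j s) u : EReal)} := fun s hs v =>
    honest.integral_report_eq_sum h_meas h_range r_range (hB s hs).1 v x.2
  have hFm : ∀ s, Measurable (F s) := fun s => by
    have h1 : Measurable (fun p : 𝒱 × 𝒰 => (r (h (setTreatment x j s) p.2) p.1 : ℝ)) :=
      measurable_from_top.comp (r_meas.comp
        ((h_meas.comp (measurable_const.prodMk measurable_snd)).prodMk measurable_fst))
    exact (h1.stronglyMeasurable.integral_kernel_prod_right'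
      (κ := η.comap (fun v => (x.2, v)) measurable_prodMk_left)).measurable
  have hFint : Integrable (F (x.1 j)) (κ x.2) := by
    refine Integrable.of_bound (hFm _).aestronglyMeasurable Rbar (ae_of_all _ fun v => ?_)
    refine (norm_integral_le_of_norm_le_const (C := (Rbar : ℝ)) (ae_of_all _ fun u => ?_)).trans
      (by simp)
    simpa using r_range _ (h_range _ (hB _ hxB).1 u) v
  have hderiv : ∀ v, HasDerivAt (fun s => F s v) (∑ k ∈ Finset.range Rbar,
      densityAt (f x v) (threshold 𝓗 r v k) *
        localResponse f g x v (threshold 𝓗 r v k).toReal) (x.1 j) := fun v => by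
    refine (HasDerivAt.fun_sum fun k _ => (hsurv v (threshold 𝓗 r v k)).1).congr_of_eventuallyEq ?_
    filter_upwards [hBn] with s hs using hFsum s hs v
  have hlip : ∀ v, LipschitzOnWith (Real.nnabs (Rbar * ∫ z, c z * |z|)) (fun s => F s v) B :=
    fun v => by
    refine LipschitzOnWith.of_dist_le_mul fun t ht s hs => ?_
    rw [Real.dist_eq, Real.dist_eq, hFsum t ht, hFsum s hs, ← Finset.sum_sub_distrib]
    calc _ ≤ ∑ k ∈ Finset.range Rbar, (∫ z, c z * |z|) * |t - s| :=
          (Finset.abs_sum_le_sum_abs _ _).trans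
            (Finset.sum_le_sum fun k _ => (hsurv v (threshold 𝓗 r v k)).2 s hs t ht)
      _ = (Rbar * ∫ z, c z * |z|) * |t - s| := by simp [mul_assoc]
      _ ≤ _ := mul_le_mul_of_nonneg_right (le_abs_self _) (abs_nonneg _)
  -- Measurability in `v` comes from the integrand being a pointwise limit of difference quotients
  -- of `F`, so the thresholds need not be shown measurable.
  have hF'm : Measurable (fun v => ∑ k ∈ Finset.range Rbar,
      densityAt (f x v) (threshold 𝓗 r v k) *
        localResponse f g x v (threshold 𝓗 r v k).toReal) := by
    refine measurable_of_tendsto_metrizable (f := fun (n : ℕ) v =>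
      ((1 : ℝ) / (n + 1))⁻¹ * (F (x.1 j + 1 / (n + 1)) v - F (x.1 j) v))
      (fun n => ((hFm _).sub (hFm _)).const_mul _) (tendsto_pi_nhds.2 fun v => ?_)
    exact (hderiv v).tendsto_slope_zero_right.comp
      (tendsto_nhdsWithin_iff.2 ⟨tendsto_one_div_add_atTop_nhds_zero_nat,
        .of_forall fun n => by simp only [Set.mem_Ioi]; positivity⟩)
  -- The Lipschitz constant is the same for all `v`, hence integrable against the probability
  -- measure `κ x.2`; this also yields integrability of the derivative.
  exact hasDerivAt_integral_of_dominated_loc_of_lip hBn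
    (.of_forall fun s => (hFm s).aestronglyMeasurable) hFint hF'm.aestronglyMeasurable
    (ae_of_all _ hlip) (integrable_const _) (ae_of_all _ hderiv)

end Derivative

end SubjectiveReports

open SubjectiveReports in
theorem corollary1
    {Ω : Type*} [MeasurableSpace Ω] [StandardBorelSpace Ω]
    {𝒰 : Type*} [MeasurableSpace 𝒰] [StandardBorelSpace 𝒰]
    {𝒱 : Type*} [MeasurableSpace 𝒱] [StandardBorelSpace 𝒱]
    (μ : Measure Ω) [IsProbabilityMeasure μ]
    {J K : ℕ}
    -- treatments, controls, and the two sources of unobserved heterogeneity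
    (T : Ω → Fin J → ℝ) (W : Ω → Fin K → ℝ) (U : Ω → 𝒰) (V : Ω → 𝒱)
    (hT : Measurable T) (hW : Measurable W) (hU : Measurable U) (hV : Measurable V)
    -- possible covariate values and possible latent values
    (𝒳 : Set (Covariates J K)) (h_𝒳 : ∀ᵐ ω ∂μ, (T ω, W ω) ∈ 𝒳)
    (𝓗 : Set ℝ) (h_𝓗 : 𝓗 ⊆ closure (interior 𝓗))
    -- the structural function and the reporting functions, with categories `0, …, Rbar`
    (h : Covariates J K → 𝒰 → ℝ) (h_meas : Measurable (fun p : Covariates J K × 𝒰 => h p.1 p.2))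
    (h_range : ∀ x ∈ 𝒳, ∀ u, h x u ∈ 𝓗)
    (Rbar : ℕ) (r : ℝ → 𝒱 → ℕ) (r_meas : Measurable (fun p : ℝ × 𝒱 => r p.1 p.2))
    (r_range : ∀ y ∈ 𝓗, ∀ v, r y v ≤ Rbar)
    (honest : Honest 𝓗 r)
    -- exogeneity
    (exog_V : CondIndepFun (MeasurableSpace.comap W inferInstance) hW.comap_le T V μ)
    (exog_U : CondIndepFun (MeasurableSpace.comap (fun ω => (W ω, V ω)) inferInstance)
      (hW.prodMk hV).comap_le T U μ)
    -- regular conditional laws of `V` given `W`, and of `U` given `(W, V)`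
    (κ : Kernel (Fin K → ℝ) 𝒱) [IsMarkovKernel κ] (h_κ : HasCondDistrib V W κ μ)
    (η : Kernel ((Fin K → ℝ) × 𝒱) 𝒰) [IsMarkovKernel η]
    (h_η : HasCondDistrib U (fun ω => (W ω, V ω)) η μ)
    -- density of `H` given `(X, V)`, and joint densities of `(H, ∂_{x_j} h)` given `(X, V)`
    (f : Covariates J K → 𝒱 → ℝ → ℝ)
    (g : Fin J → Covariates J K → 𝒱 → ℝ → ℝ → ℝ) :
    -- `κ w` is the law of `V` given `X = (t, w)`
    HasCondDistrib V (fun ω => (T ω, W ω)) (κ.comap (fun x : Covariates J K => x.2) (by fun_prop)) μ ∧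
    -- `η (w, v)` is the law of `U` given `X = (t, w)` and `V = v`
    HasCondDistrib U (fun ω => ((T ω, W ω), V ω))
      (η.comap (fun p : Covariates J K × 𝒱 => (p.1.2, p.2)) (by fun_prop)) μ ∧
    -- `meanReport` is the conditional expectation of `R = r (h (X, U), V)` given `X`
    (fun ω => meanReport h r κ η (T ω, W ω)) =ᵐ[μ]
      μ[(fun ω => (r (h (T ω, W ω) (U ω)) (V ω) : ℝ)) |
        MeasurableSpace.comap (fun ω => (T ω, W ω)) inferInstance] ∧
    -- its gradient in the components that satisfy the regularity conditions
    ∀ j : Fin J, Regular μ T 𝒳 𝓗 h η f (g j) j → ∀ x, InteriorAlong 𝒳 j x →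
      (∀ v k, 0 ≤ densityAt (f x v) (threshold 𝓗 r v k)) ∧
      Integrable (fun v => ∑ k ∈ Finset.range Rbar,
        densityAt (f x v) (threshold 𝓗 r v k) *
          localResponse f (g j) x v (threshold 𝓗 r v k).toReal) (κ x.2) ∧
      HasDerivAt (fun s => meanReport h r κ η (setTreatment x j s))
        (∫ v, ∑ k ∈ Finset.range Rbar,
          densityAt (f x v) (threshold 𝓗 r v k) *
            localResponse f (g j) x v (threshold 𝓗 r v k).toReal ∂(κ x.2))
        (x.1 j) := by
  have h_V := hasCondDistrib_report_type hT hW hV exog_V h_κ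
  have h_U := hasCondDistrib_outcome_type hT hW hU hV exog_U h_η
  refine ⟨h_V, h_U,
    meanReport_ae_eq_condExp hT hW hU hV h_𝒳 h_meas h_range r_meas r_range h_V h_U,
    fun j reg x hx => ⟨fun v k => reg.densityAt_nonneg hx v _, ?_⟩⟩
  exact reg.hasDerivAt_meanReport h_𝓗 h_meas h_range r_meas r_range honest hx
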